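/- Let $0\le k<1$ and consider on $\mathbb R^6$ the quadratic homogeneous system of the Bianchi class A cosmologies $$\begin{aligned} \dot x_1&=x_1(-x_4+x_5+x_6), & \dot x_4&=n_1x_1(n_1x_1-n_2x_2-n_3x_3)+\tfrac{k-1}{4}F,\\ \dot x_2&=x_2(x_4-x_5+x_6), & \dot x_5&=n_2x_2(-n_1x_1+n_2x_2-n_3x_3)+\tfrac{k-1}{4}F,\\ \dot x_3&=x_3(x_4+x_5-x_6), & \dot x_6&=n_3x_3(-n_1x_1-n_2x_2+n_3x_3)+\tfrac{k-1}{4}F, \end{aligned}$$ $$F=n_1^2x_1^2+n_2^2x_2^2+n_3^2x_3^2-2n_1n_2x_1x_2-2n_1n_3x_1x_3-2n_2n_3x_2x_3+x_4^2+x_5^2+x_6^2-2x_4x_5-2x_5x_6-2x_4x_6,$$ where $(n_1,n_2,n_3)$ is $(0,0,0)$ for type I, $(1,0,0)$ for type II, $(1,-1,0)$ for type VI$_0$, $(1,1,0)$ for type VII$_0$, $(1,1,-1)$ for type VIII and $(1,1,1)$ for type IX. A first integral on an open dense set $U\subseteq\mathbb R^6$ is a non-constant $C^1$ function $U\to\mathbb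 R$ whose derivative along the system vanishes on $U$; a polynomial first integral is a polynomial with this property. An analytic first integral is a non-constant real-analytic function on a connected open neighbourhood $W$ of the origin whose derivative along the system vanishes on $W$. Functions are independent at a point if their differentials there are linearly independent. The system is completely integrable if it has five first integrals on an open dense set that are independent at each of its points. Put $\mathcal H=|x_1x_2x_3|^{\frac{k-1}{2}}F$ on $\{x_1x_2x_3\ne0\}$ and $K=x_5-x_6$. (a) Type I is completely integrable. Namely, with $\Delta=x_4^2+x_5^2+x_6^2-x_4x_5-x_5x_6-x_4x_6$ and $Q=\left|\frac{x_4+x_5+x_6-2\sqrt\Delta}{x_4+x_5+x_6+2\sqrt\Delta}\right|$, the functions $$x_4-x_5,\quad x_4-x_6,\quad \mathcal H,\quad \left|\tfrac{x_1}{x_2}\right|^{\frac{1-k}{2}}Q^{\frac{x_4-x_5}{\sqrt\Delta}},\quad \left|\tfrac{x_2}{x_3}\right|^{\frac{1-k}{2}}Q^{\frac{x_5-x_6}{\sqrt\Delta}}$$ are real-analytic first integrals on the open dense set $\{x_1x_2x_3\neq0,\ \Delta\ne0,\ (x_4+x_5+x_6)^2\ne4\Delta\}$, independent at each of its points. (b)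 For type II, $K$ is a (polynomial) first integral on $\mathbb R^6$ and $\mathcal H$ is a first integral on $\{x_1x_2x_3\neq 0\}$, and the two are independent at each point of $\{x_1x_2x_3\neq0\}$. There is no additional polynomial or analytic first integral independent of them: for every polynomial first integral $P$, the functions $\mathcal H,K,P$ are dependent at every point with $x_1x_2x_3\neq0$, and for every analytic first integral $f$ on $W$, the functions $\mathcal H,K,f$ are dependent at every point of $W$ with $x_1x_2x_3\ne0$. (c) Types VI$_0$ and VII$_0$ have no polynomial first integrals and no analytic first integrals. (d) Types VIII and IX have no polynomial first integrals and no analytic first integrals. -/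

import Mathlib

/-!  Bianchi class A cosmologies with equation of state `p = k ε`, as a quadratic homogeneous
polynomial differential system on `ℝ⁶`. The coordinates `x₁, …, x₆` are `x 0, …, x 5`. -/

noncomputable section

namespace Bianchi

/-- The six types of class A. -/
inductive ClassA
  | I | II | VI0 | VII0 | VIII | IX

/-- The structure constants `(n₁, n₂, n₃)` of each type. -/
def ClassA.n : ClassA → Fin 3 → ℝ
  | .I => ![0, 0, 0]
  | .II => ![1, 0, 0]
  | .VI0 => ![1, -1, 0]
  | .VII0 => ![1, 1, 0]
  | .VIII => ![1, 1, -1]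
  | .IX => ![1, 1, 1]

/-- The quadratic form `F`. -/
def F (T : ClassA) (x : Fin 6 → ℝ) : ℝ :=
  T.n 0 ^ 2 * x 0 ^ 2 + T.n 1 ^ 2 * x 1 ^ 2 + T.n 2 ^ 2 * x 2 ^ 2
    - 2 * T.n 0 * T.n 1 * x 0 * x 1 - 2 * T.n 0 * T.n 2 * x 0 * x 2
    - 2 * T.n 1 * T.n 2 * x 1 * x 2
    + x 3 ^ 2 + x 4 ^ 2 + x 5 ^ 2 - 2 * x 3 * x 4 - 2 * x 4 * x 5 - 2 * x 3 * x 5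

/-- The right-hand side of the system `ẋ = X(x)`. -/
def field (T : ClassA) (k : ℝ) (x : Fin 6 → ℝ) : Fin 6 → ℝ :=
  ![x 0 * (-x 3 + x 4 + x 5),
    x 1 * (x 3 - x 4 + x 5),
    x 2 * (x 3 + x 4 - x 5),
    T.n 0 * x 0 * (T.n 0 * x 0 - T.n 1 * x 1 - T.n 2 * x 2) + (k - 1) / 4 * F T x,
    T.n 1 * x 1 * (-T.n 0 * x 0 + T.n 1 * x 1 - T.n 2 * x 2) + (k - 1) / 4 * F T x,
    T.n 2 * x 2 * (-T.n 0 * x 0 - T.n 1 * x 1 + T.n 2 * x 2) + (k - 1) / 4 * F T x]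

/-- `f` is a first integral of `ẋ = X(x)` on the open and dense set `U`: a non-constant `C¹`
function on `U` whose derivative along `X` vanishes. -/
structure IsFirstIntegral (X : (Fin 6 → ℝ) → (Fin 6 → ℝ)) (U : Set (Fin 6 → ℝ))
    (f : (Fin 6 → ℝ) → ℝ) : Prop where
  isOpen : IsOpen U
  dense : Dense U
  contDiffOn : ContDiffOn ℝ 1 f U
  nonconstant : ¬ ∃ c : ℝ, ∀ x ∈ U, f x = c
  derivative_eq_zero : ∀ x ∈ U, fderiv ℝ f x (X x) = 0

/-- The polynomial `P` is a first integral (on some open and dense set). -/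
def IsPolynomialFirstIntegral (X : (Fin 6 → ℝ) → (Fin 6 → ℝ)) (P : MvPolynomial (Fin 6) ℝ) :
    Prop :=
  ∃ U : Set (Fin 6 → ℝ), IsFirstIntegral X U (fun x => MvPolynomial.eval x P)

/-- `f` is an analytic first integral on the connected open neighbourhood `W` of the origin
(no density is asked of `W`, so functions given by a power series at `0` are included). -/
structure IsAnalyticFirstIntegral (X : (Fin 6 → ℝ) → (Fin 6 → ℝ)) (W : Set (Fin 6 → ℝ))
    (f : (Fin 6 → ℝ) → ℝ) : Prop where
  isOpen : IsOpen W
  isConnected : IsConnected W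
  zero_mem : (0 : Fin 6 → ℝ) ∈ W
  analytic : AnalyticOnNhd ℝ f W
  nonconstant : ¬ ∃ c : ℝ, ∀ x ∈ W, f x = c
  derivative_eq_zero : ∀ x ∈ W, fderiv ℝ f x (X x) = 0

/-- The functions `f 0, …, f (m-1)` are independent at `x`: so are their differentials. -/
def IndependentAt {m : ℕ} (f : Fin m → (Fin 6 → ℝ) → ℝ) (x : Fin 6 → ℝ) : Prop :=
  LinearIndependent ℝ (fun i => fderiv ℝ (f i) x)

/-- The system in dimension six admits five independent first integrals. -/
def CompletelyIntegrable (X : (Fin 6 → ℝ) → (Fin 6 → ℝ)) : Prop :=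
  ∃ (U : Set (Fin 6 → ℝ)) (f : Fin 5 → (Fin 6 → ℝ) → ℝ),
    (∀ i, IsFirstIntegral X U (f i)) ∧ ∀ x ∈ U, IndependentAt f x

/-- The open dense set `x₁x₂x₃ ≠ 0`. -/
def regular : Set (Fin 6 → ℝ) := {x | x 0 * x 1 * x 2 ≠ 0}

/-- `𝓗 = (x₁x₂x₃)^((k-1)/2) F`; the absolute value makes the real power meaningful on all
of `regular`. -/
def H (T : ClassA) (k : ℝ) (x : Fin 6 → ℝ) : ℝ :=
  |x 0 * x 1 * x 2| ^ ((k - 1) / 2) * F T x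

/-- `K = x₅ - x₆`. -/
def K : MvPolynomial (Fin 6) ℝ := MvPolynomial.X 4 - MvPolynomial.X 5

/-- `Δ = x₄² + x₅² + x₆² - x₄x₅ - x₅x₆ - x₄x₆`. -/
def Δ (x : Fin 6 → ℝ) : ℝ :=
  x 3 ^ 2 + x 4 ^ 2 + x 5 ^ 2 - x 3 * x 4 - x 4 * x 5 - x 3 * x 5

/-- `|(x₄+x₅+x₆ - 2√Δ) / (x₄+x₅+x₆ + 2√Δ)|`. -/
def quotient (x : Fin 6 → ℝ) : ℝ :=
  |(x 3 + x 4 + x 5 - 2 * √(Δ x)) / (x 3 + x 4 + x 5 + 2 * √(Δ x))|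

/-- The five first integrals of type I. -/
def typeIIntegrals (k : ℝ) : Fin 5 → (Fin 6 → ℝ) → ℝ :=
  ![fun x => x 3 - x 4,
    fun x => x 3 - x 5,
    H .I k,
    fun x => |x 0 / x 1| ^ ((1 - k) / 2) * quotient x ^ ((x 3 - x 4) / √(Δ x)),
    fun x => |x 1 / x 2| ^ ((1 - k) / 2) * quotient x ^ ((x 4 - x 5) / √(Δ x))]

/-- The set where all quantities raised to a power in `typeIIntegrals`, and all denominators,
are defined and nonzero. -/
def typeIDomain : Set (Fin 6 → ℝ) :=
  {x | x 0 * x 1 * x 2 ≠ 0 ∧ Δ x ≠ 0 ∧ (x 3 + x 4 + x 5) ^ 2 ≠ 4 * Δ x}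

end Bianchi

end

noncomputable section

namespace Bianchi

/-! ### Polynomials constant along the flow -/

open MvPolynomial Filter Topology

/-! Non-existence rests on a commutator. Let X be the field, D = ∂₄ + ∂₅ + ∂₆, E the Euler field in
x₁, x₂, x₃, and τ = x₄ + x₅ + x₆. Then [D, X] = E + ((1-k)/2) τ D, while D commutes with E and Dτ =
3. If XP = 0 and m ≥ 2 with D^m P = 0, iterating the commutator leaves (E + μ) D^(m-1) P = 0 with μ
> 0. Since E is diagonal on monomials with eigenvalues ≥ 0, D^(m-1) P = 0. As D is locally
nilpotent, this descends to DP = 0, and then the commutator itself gives EP = 0: P depends on x₄,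
x₅, x₆ only (`isoDer_eq_zero_and_eulerDer_eq_zero`). The F-terms of XP now cancel, and the
coefficient of xᵢ² shows that nᵢ ≠ 0 kills the partial derivative in the i-th of x₄, x₅, x₆. Two
nonzero nᵢ force P constant; for type II, dP is proportional to dK.

Since X is homogeneous, it annihilates each Taylor component at 0 of an analytic integral, so the
linear conditions on derivatives pass from polynomials to the function near 0, and by the identity
theorem to W (`fderiv_apply_eq_zero_of_polynomial`).

The explicit integrals come from XF = ((1-k)/2) τ F and X(x₁x₂x₃) = τ x₁x₂x₃. For type I the
differences of x₄, x₅, x₆, hence Δ, are constant, and τ obeys a scalar Riccati equation whose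
solution produces Q. -/

/-- The polynomial `F`. -/
def FPoly (T : ClassA) : MvPolynomial (Fin 6) ℝ :=
  C (T.n 0) ^ 2 * X 0 ^ 2 + C (T.n 1) ^ 2 * X 1 ^ 2 + C (T.n 2) ^ 2 * X 2 ^ 2
    - 2 * C (T.n 0) * C (T.n 1) * X 0 * X 1 - 2 * C (T.n 0) * C (T.n 2) * X 0 * X 2
    - 2 * C (T.n 1) * C (T.n 2) * X 1 * X 2
    + X 3 ^ 2 + X 4 ^ 2 + X 5 ^ 2 - 2 * X 3 * X 4 - 2 * X 4 * X 5 - 2 * X 3 * X 5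

/-- The components of the vector field as polynomials. -/
def fieldPoly (T : ClassA) (k : ℝ) : Fin 6 → MvPolynomial (Fin 6) ℝ :=
  ![X 0 * (-X 3 + X 4 + X 5),
    X 1 * (X 3 - X 4 + X 5),
    X 2 * (X 3 + X 4 - X 5),
    C (T.n 0) * X 0 * (C (T.n 0) * X 0 - C (T.n 1) * X 1 - C (T.n 2) * X 2)
      + C ((k - 1) / 4) * FPoly T,
    C (T.n 1) * X 1 * (-C (T.n 0) * X 0 + C (T.n 1) * X 1 - C (T.n 2) * X 2)
      + C ((k - 1) / 4) * FPoly T,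
    C (T.n 2) * X 2 * (-C (T.n 0) * X 0 - C (T.n 1) * X 1 + C (T.n 2) * X 2)
      + C ((k - 1) / 4) * FPoly T]

/-- The derivation along the vector field. -/
def fieldDer (T : ClassA) (k : ℝ) :
    Derivation ℝ (MvPolynomial (Fin 6) ℝ) (MvPolynomial (Fin 6) ℝ) :=
  mkDerivation ℝ (fieldPoly T k)

/-- The derivation along the isotropic direction `(0, 0, 0, 1, 1, 1)`. -/
def isoDer : Derivation ℝ (MvPolynomial (Fin 6) ℝ) (MvPolynomial (Fin 6) ℝ) :=
  mkDerivation ℝ ![0, 0, 0, 1, 1, 1]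

/-- The Euler derivation in `x₁, x₂, x₃`. -/
def eulerDer : Derivation ℝ (MvPolynomial (Fin 6) ℝ) (MvPolynomial (Fin 6) ℝ) :=
  mkDerivation ℝ ![X 0, X 1, X 2, 0, 0, 0]

lemma mkDerivation_eq_sum_pderiv {σ : Type*} [Fintype σ] (f : σ → MvPolynomial σ ℝ)
    (P : MvPolynomial σ ℝ) :
    mkDerivation ℝ f P = ∑ i, f i * pderiv i P := by
  classical
  have hsum : ∀ Q, (∑ i, f i • pderiv i : Derivation ℝ (MvPolynomial σ ℝ) (MvPolynomial σ ℝ)) Q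
      = ∑ i, f i * pderiv i Q := fun Q => by
    rw [← Derivation.coeFnAddMonoidHom_apply, map_sum, Finset.sum_apply]
    simp
  have h : mkDerivation ℝ f = ∑ i, f i • pderiv i := by
    refine derivation_ext fun j => ?_
    rw [mkDerivation_X, hsum]
    simp [pderiv_X, Pi.single_apply]
  rw [h, hsum]

/-- The trace `x₄ + x₅ + x₆`. -/
def trace : MvPolynomial (Fin 6) ℝ := X 3 + X 4 + X 5

lemma isoDer_trace : isoDer trace = 3 := by
  simp [isoDer, trace, mkDerivation_X]; norm_num

/-- Both sides are derivations, so generators suffice. The Euler term comes from the first three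
components; the trace term from DF = -2τ, independently of the type. -/
lemma isoDer_fieldDer (T : ClassA) (k : ℝ) (P : MvPolynomial (Fin 6) ℝ) :
    isoDer (fieldDer T k P) = fieldDer T k (isoDer P) + eulerDer P
      + ((1 - k) / 2) • (trace * isoDer P) := by
  have h : ⁅isoDer, fieldDer T k⁆ = eulerDer + (C ((1 - k) / 2) * trace) • isoDer := by
    have hc : (C ((k - 1) / 4) : MvPolynomial (Fin 6) ℝ) * 2 = - C ((1 - k) / 2) := by
      have : (2 : MvPolynomial (Fin 6) ℝ) = C 2 := (map_ofNat C 2).symm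
      rw [this, ← C_mul, ← C_neg]; congr 1; ring
    have h2 : mkDerivation ℝ (![0, 0, 0, 1, 1, 1] : Fin 6 → MvPolynomial (Fin 6) ℝ) 2 = 0 := by
      simpa using (mkDerivation ℝ
        (![0, 0, 0, 1, 1, 1] : Fin 6 → MvPolynomial (Fin 6) ℝ)).map_natCast 2
    refine derivation_ext fun j => ?_
    rw [Derivation.commutator_apply]
    fin_cases j <;>
      simp [isoDer, fieldDer, eulerDer, fieldPoly, FPoly, trace, Derivation.leibniz,
        Derivation.leibniz_pow, derivation_C, mkDerivation_X, h2] <;>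
      first
        | ring1
        | linear_combination (-(X 3 + X 4 + X 5 : MvPolynomial (Fin 6) ℝ)) * hc
  have := congrArg (fun D => D P) h
  simp only [Derivation.commutator_apply, Derivation.add_apply, Derivation.smul_apply,
    smul_eq_mul] at this
  rw [smul_eq_C_mul]
  linear_combination this

lemma isoDer_eulerDer (P : MvPolynomial (Fin 6) ℝ) :
    isoDer (eulerDer P) = eulerDer (isoDer P) := by
  have h : ⁅isoDer, eulerDer⁆ = 0 := by
    refine derivation_ext fun j => ?_
    rw [Derivation.commutator_apply]
    fin_cases j <;> simp [isoDer, eulerDer, mkDerivation_X]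
  have := congrArg (fun D => D P) h
  simpa [Derivation.commutator_apply, sub_eq_zero] using this

/-- The iterated commutator of the isotropic derivation with the vector field. -/
lemma isoDer_iterate_fieldDer (T : ClassA) (k : ℝ) (P : MvPolynomial (Fin 6) ℝ) (n : ℕ) :
    isoDer^[n + 1] (fieldDer T k P) = fieldDer T k (isoDer^[n + 1] P)
      + ((n : ℝ) + 1) • eulerDer (isoDer^[n] P)
      + (((n : ℝ) + 1) * ((1 - k) / 2)) • (trace * isoDer^[n + 1] P)
      + (3 * (n + 1) * n / 2 * ((1 - k) / 2)) • isoDer^[n] P := by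
  -- The constant is 3 · (n+1 choose 2) · (1-k)/2: each new application of D to the trace term
  -- contributes Dτ = 3.
  induction n with
  | zero => simp [isoDer_fieldDer]
  | succ n ih =>
    have h3 : ∀ Q : MvPolynomial (Fin 6) ℝ, Q * 3 = (3 : ℝ) • Q := fun Q => by
      rw [smul_eq_C_mul, mul_comm]; rfl
    rw [Function.iterate_succ_apply', ih]
    simp only [map_add, Derivation.leibniz, isoDer_fieldDer, isoDer_eulerDer, smul_eq_mul,
      isoDer_trace, Derivation.map_smul, ← Function.iterate_succ_apply' (f := isoDer), h3]
    push_cast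
    module

/-- The derivation has constant coefficients, so it lowers the degree of each homogeneous component
by one. -/
lemma exists_isoDer_iterate_eq_zero (P : MvPolynomial (Fin 6) ℝ) : ∃ n, isoDer^[n] P = 0 := by
  have hiter : ∀ n, ∀ Q : MvPolynomial (Fin 6) ℝ,
      isoDer^[n] Q = ((isoDer : MvPolynomial (Fin 6) ℝ →ₗ[ℝ] MvPolynomial (Fin 6) ℝ) ^ n) Q :=
    fun n Q => by rw [Module.End.pow_apply]; rfl
  have hmono : ∀ {m n : ℕ} {Q : MvPolynomial (Fin 6) ℝ}, m ≤ n → isoDer^[m] Q = 0 →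
      isoDer^[n] Q = 0 := by
    intro m n Q hmn h
    obtain ⟨l, rfl⟩ := Nat.exists_eq_add_of_le' hmn
    rw [Function.iterate_add_apply, h, hiter, map_zero]
  have hlow : ∀ (n : ℕ) (Q : MvPolynomial (Fin 6) ℝ), Q.IsHomogeneous n →
      isoDer^[n + 1] Q = 0 := by
    intro n
    have hsum : ∀ Q, isoDer Q = pderiv 3 Q + pderiv 4 Q + pderiv 5 Q := fun Q => by
      simp [isoDer, mkDerivation_eq_sum_pderiv, Fin.sum_univ_six]
    induction n with
    | zero =>
      intro Q hQ
      rw [← totalDegree_zero_iff_isHomogeneous, totalDegree_eq_zero_iff_eq_C] at hQ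
      rw [hQ]
      exact derivation_C _ _
    | succ n ih =>
      intro Q hQ
      rw [Function.iterate_succ_apply]
      refine ih _ ?_
      rw [hsum]
      exact (hQ.pderiv.add hQ.pderiv).add hQ.pderiv
  refine ⟨P.totalDegree + 1, ?_⟩
  rw [hiter]
  conv_lhs => enter [2]; rw [← sum_homogeneousComponent P]
  rw [map_sum]
  refine Finset.sum_eq_zero fun i hi => ?_
  rw [← hiter]
  exact hmono (Finset.mem_range.1 hi) (hlow i _ (homogeneousComponent_isHomogeneous i P))

lemma coeff_eulerDer (P : MvPolynomial (Fin 6) ℝ) (a : Fin 6 →₀ ℕ) :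
    coeff a (eulerDer P) = ((a 0 : ℝ) + a 1 + a 2) * coeff a P := by
  have hX : ∀ i : Fin 6, coeff a (X i * pderiv i P) = a i * coeff a P := by
    intro i
    induction P using MvPolynomial.induction_on' with
    | monomial u r =>
      rw [X_mul_pderiv_monomial, coeff_smul, coeff_monomial]
      split_ifs with h
      · simp [h]
      · simp
    | add p q hp hq => rw [map_add, mul_add, coeff_add, hp, hq, coeff_add]; ring
  rw [eulerDer, mkDerivation_eq_sum_pderiv, Fin.sum_univ_six]
  simp only [coeff_add]
  simp [hX]
  ring

/-- Monomials are eigenvectors of the operator, with eigenvalue a₀ + a₁ + a₂ + μ > 0. -/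
lemma eq_zero_of_eulerDer_add_smul_eq_zero {P : MvPolynomial (Fin 6) ℝ} {μ : ℝ} (hμ : 0 < μ)
    (h : eulerDer P + μ • P = 0) : P = 0 := by
  ext a
  have := congrArg (coeff a) h
  rw [coeff_add, coeff_eulerDer, coeff_smul, smul_eq_mul, ← add_mul, coeff_zero] at this
  exact (mul_eq_zero.1 this).resolve_left (by positivity)

lemma pderiv_eq_zero_of_eulerDer_eq_zero {P : MvPolynomial (Fin 6) ℝ} (h : eulerDer P = 0) :
    pderiv 0 P = 0 ∧ pderiv 1 P = 0 ∧ pderiv 2 P = 0 := by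
  have hc : ∀ a : Fin 6 →₀ ℕ, (a 0 : ℝ) + a 1 + a 2 ≠ 0 → coeff a P = 0 := by
    intro a ha
    have := congrArg (coeff a) h
    rw [coeff_eulerDer, coeff_zero] at this
    exact (mul_eq_zero.1 this).resolve_left ha
  refine ⟨?_, ?_, ?_⟩ <;>
  · ext a
    rw [coeff_pderiv, hc, zero_mul, coeff_zero]
    simp
    positivity

/-- A polynomial constant along the vector field does not depend on `x₁, x₂, x₃` and is invariant
under the isotropic translations. -/
lemma isoDer_eq_zero_and_eulerDer_eq_zero {T : ClassA} {k : ℝ} (hk : k < 1)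
    {P : MvPolynomial (Fin 6) ℝ} (hP : fieldDer T k P = 0) :
    isoDer P = 0 ∧ eulerDer P = 0 := by
  have hz : ∀ n, isoDer^[n] (0 : MvPolynomial (Fin 6) ℝ) = 0 := fun n =>
    Function.iterate_fixed (map_zero _) n
  have hstep : ∀ n, isoDer^[n + 2] P = 0 → isoDer^[n + 1] P = 0 := by
    intro n hn
    have h := isoDer_iterate_fieldDer T k P (n + 1)
    rw [hP, hz, hn, map_zero, mul_zero, smul_zero, add_zero, zero_add] at h
    -- This is the zeroth-order coefficient divided by n + 2. It is positive because the descent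
    -- stops at the first derivative; one step lower it would be 0.
    refine eq_zero_of_eulerDer_add_smul_eq_zero (μ := 3 * (n + 1) / 2 * ((1 - k) / 2)) ?_ ?_
    · have : 0 < 1 - k := by linarith
      positivity
    · have h2 : ((n : ℝ) + 2) ≠ 0 := by positivity
      refine (smul_eq_zero.1 ?_).resolve_left h2
      rw [h, smul_add, smul_smul]
      push_cast
      module
  have hiso : isoDer P = 0 := by
    obtain ⟨n, hn⟩ := exists_isoDer_iterate_eq_zero P
    have : ∀ n, isoDer^[n + 1] P = 0 → isoDer P = 0 := by
      intro n
      induction n with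
      | zero => exact id
      | succ n ih => exact fun h => ih (hstep n h)
    exact this n (by rw [Function.iterate_succ_apply', hn, map_zero])
  refine ⟨hiso, ?_⟩
  have h := isoDer_fieldDer T k P
  rw [hP, hiso] at h
  simpa using h.symm

/-- The derivatives of a polynomial constant along the vector field. -/
lemma pderiv_eq_zero_of_fieldDer_eq_zero {T : ClassA} {k : ℝ} (hk : k < 1)
    {P : MvPolynomial (Fin 6) ℝ} (hP : fieldDer T k P = 0) :
    pderiv 0 P = 0 ∧ pderiv 1 P = 0 ∧ pderiv 2 P = 0 ∧ pderiv 3 P + pderiv 4 P + pderiv 5 P = 0 ∧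
      (T.n 0 ≠ 0 → pderiv 3 P = 0) ∧ (T.n 1 ≠ 0 → pderiv 4 P = 0) ∧
      (T.n 2 ≠ 0 → pderiv 5 P = 0) := by
  obtain ⟨hiso, heul⟩ := isoDer_eq_zero_and_eulerDer_eq_zero hk hP
  obtain ⟨h0, h1, h2⟩ := pderiv_eq_zero_of_eulerDer_eq_zero heul
  have hD : pderiv 3 P + pderiv 4 P + pderiv 5 P = 0 := by
    simpa [isoDer, mkDerivation_eq_sum_pderiv, Fin.sum_univ_six] using hiso
  have hX : C (T.n 0) * X 0 * (C (T.n 0) * X 0 - C (T.n 1) * X 1 - C (T.n 2) * X 2) * pderiv 3 P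
      + C (T.n 1) * X 1 * (-C (T.n 0) * X 0 + C (T.n 1) * X 1 - C (T.n 2) * X 2) * pderiv 4 P
      + C (T.n 2) * X 2 * (-C (T.n 0) * X 0 - C (T.n 1) * X 1 + C (T.n 2) * X 2) * pderiv 5 P
      = 0 := by
    rw [fieldDer, mkDerivation_eq_sum_pderiv, Fin.sum_univ_six, h0, h1, h2] at hP
    simp [fieldPoly] at hP
    linear_combination hP - C ((k - 1) / 4) * FPoly T * hD
  have hcomm : ∀ i j : Fin 6, pderiv i P = 0 → pderiv i (pderiv j P) = 0 := by
    intro i j h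
    have : ⁅pderiv (R := ℝ) i, pderiv (R := ℝ) j⁆ = 0 := by
      refine derivation_ext fun l => ?_
      classical
      rw [Derivation.commutator_apply, pderiv_X, pderiv_X]
      simp only [Pi.single_apply]
      split_ifs <;> simp
    have := congrArg (fun D => D P) this
    simpa [Derivation.commutator_apply, h] using this
  refine ⟨h0, h1, h2, hD, fun hn => ?_, fun hn => ?_, fun hn => ?_⟩
  -- Differentiating twice extracts the square of this variable, which occurs only in the first
  -- summand; the partial derivatives of P do not involve the variable.
  · have := congrArg (fun Q => pderiv 0 (pderiv 0 Q)) hX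
    simpa [hcomm 0 _ h0, pderiv_X, Derivation.leibniz, hn] using this
  · have := congrArg (fun Q => pderiv 1 (pderiv 1 Q)) hX
    simpa [hcomm 1 _ h1, pderiv_X, Derivation.leibniz, hn] using this
  · have := congrArg (fun Q => pderiv 2 (pderiv 2 Q)) hX
    simpa [hcomm 2 _ h2, pderiv_X, Derivation.leibniz, hn] using this

/-! ### Homogeneous components of analytic functions -/

section PowerSeries

variable {E G : Type*} [NormedAddCommGroup E] [NormedSpace ℝ E] [NormedAddCommGroup G]
  [NormedSpace ℝ G]

lemma derivSeries_congr {p q : FormalMultilinearSeries ℝ E G} {n : ℕ}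
    (h : p (n + 1) = q (n + 1)) : p.derivSeries n = q.derivSeries n := by
  have h' : p (1 + n) = q (1 + n) := by rw [add_comm]; exact h
  have : p.changeOriginSeries 1 n = q.changeOriginSeries 1 n := by
    simp only [FormalMultilinearSeries.changeOriginSeries,
      FormalMultilinearSeries.changeOriginSeriesTerm, h']
  ext v
  simp [FormalMultilinearSeries.derivSeries, this]

/-- The derivative of a homogeneous component of a power series is the corresponding component
of the differentiated series. -/
lemma fderiv_diag_eq_derivSeries [CompleteSpace G] (p : FormalMultilinearSeries ℝ E G) (n : ℕ)
    (y : E) :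
    fderiv ℝ (fun x => p (n + 1) fun _ => x) y = p.derivSeries n fun _ => y := by
  -- Isolating one term gives a series that converges everywhere, so its sum can be differentiated
  -- termwise at any `y`, whatever the radius of `p`.
  let q : FormalMultilinearSeries ℝ E G := fun m => if m = n + 1 then p m else 0
  have hq : q (n + 1) = p (n + 1) := by simp [q]
  have hq0 : ∀ m, m ≠ n + 1 → q m = 0 := fun m hm => by simp [q, hm]
  have hfin := q.hasFiniteFPowerSeriesOnBall_of_finite (n := n + 1 + 1)
    fun m hm => hq0 m (by omega)
  have hsum : q.sum = fun x => p (n + 1) fun _ => x := by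
    funext x
    rw [FormalMultilinearSeries.sum, tsum_eq_single (n + 1), hq]
    intro m hm
    rw [hq0 m hm]; rfl
  rw [hsum] at hfin
  have hs := hfin.fderiv.toHasFPowerSeriesOnBall.hasSum (y := y) (by simp)
  rw [zero_add] at hs
  refine hs.unique ?_
  rw [← derivSeries_congr hq]
  refine hasSum_single n fun m hm => ?_
  rw [q.derivSeries_eq_zero (hq0 _ (by omega))]; rfl

end PowerSeries

lemma exists_mvPolynomial_eval_eq {σ : Type*} [Fintype σ] {n : ℕ}
    (p : ContinuousMultilinearMap ℝ (fun _ : Fin n => σ → ℝ) ℝ) :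
    ∃ P : MvPolynomial σ ℝ, ∀ y, eval y P = p fun _ => y := by
  classical
  -- Multilinear expansion of p(y, …, y) in the standard basis.
  refine ⟨∑ s : Fin n → σ, (∏ i, X (s i)) * C (p fun i => Pi.single (s i) 1), fun y => ?_⟩
  have hy : y = ∑ j, y j • Pi.single j (1 : ℝ) := by
    simpa [← Pi.single_smul] using (Finset.univ_sum_single y).symm
  conv_rhs => rw [hy]
  rw [p.map_sum]
  simp only [map_sum, map_mul, map_prod, eval_X, eval_C, p.map_smul_univ, smul_eq_mul]

lemma hasFDerivAt_eval {σ : Type*} [Fintype σ] (P : MvPolynomial σ ℝ) (x : σ → ℝ) :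
    HasFDerivAt (fun y => eval y P)
      (∑ i, eval x (pderiv i P) • ContinuousLinearMap.proj (R := ℝ) (φ := fun _ : σ => ℝ) i) x := by
  classical
  induction P using MvPolynomial.induction_on with
  | C a => simpa using! hasFDerivAt_const a x
  | add p q hp hq => simpa [add_smul, Finset.sum_add_distrib] using! hp.add hq
  | mul_X p i hp =>
    have h := hp.mul ((ContinuousLinearMap.proj (R := ℝ) (φ := fun _ : σ => ℝ) i).hasFDerivAt
      (x := x))
    simp only [map_mul, eval_X]
    refine h.congr_fderiv ?_
    ext v
    simp [pderiv_X, Pi.single_apply, Finset.mul_sum, add_mul, Finset.sum_add_distrib,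
      apply_ite (eval x), mul_assoc]

lemma fderiv_eval_apply {σ : Type*} [Fintype σ] (P : MvPolynomial σ ℝ) (x v : σ → ℝ) :
    fderiv ℝ (fun y => eval y P) x v = ∑ i, v i * eval x (pderiv i P) := by
  rw [(hasFDerivAt_eval P x).fderiv]
  simp [mul_comm]

/-! ### Analytic first integrals -/

lemma eval_fieldPoly (T : ClassA) (k : ℝ) (x : Fin 6 → ℝ) (i : Fin 6) :
    eval x (fieldPoly T k i) = field T k x i := by
  fin_cases i <;> simp [fieldPoly, field, FPoly, F]

lemma fderiv_eval_field (T : ClassA) (k : ℝ) (P : MvPolynomial (Fin 6) ℝ) (x : Fin 6 → ℝ) :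
    fderiv ℝ (fun y => eval y P) x (field T k x) = eval x (fieldDer T k P) := by
  rw [fderiv_eval_apply, fieldDer, mkDerivation_eq_sum_pderiv, map_sum]
  simp [eval_fieldPoly]

lemma field_smul (T : ClassA) (k t : ℝ) (x : Fin 6 → ℝ) :
    field T k (t • x) = t ^ 2 • field T k x := by
  funext i
  fin_cases i <;> simp [field, F] <;> ring

/-- The homogeneous components of an analytic function constant along the vector field are
constant along the vector field. -/
lemma derivSeries_field_eq_zero {T : ClassA} {k : ℝ} {f : (Fin 6 → ℝ) → ℝ}
    {p : FormalMultilinearSeries ℝ (Fin 6 → ℝ) ℝ} (hp : HasFPowerSeriesAt f p 0)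
    (hf : ∀ᶠ x in 𝓝 0, fderiv ℝ f x (field T k x) = 0) (n : ℕ) (x : Fin 6 → ℝ) :
    p.derivSeries n (fun _ => x) (field T k x) = 0 := by
  obtain ⟨r, hr⟩ := hp
  -- Restrict to the line t ↦ t x. There the field is t² times its value at `x`, so for small t ≠ 0
  -- the derivative of `f` at t x vanishes in the fixed direction `field T k x`; all coefficients in
  -- t therefore vanish.
  let u : ℝ →L[ℝ] (Fin 6 → ℝ) := ContinuousLinearMap.toSpanSingleton ℝ x
  have hu0 : u 0 = 0 := map_zero u
  have h1 : HasFPowerSeriesAt (fderiv ℝ f ∘ u) (p.derivSeries.compContinuousLinearMap u) 0 := by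
    refine HasFPowerSeriesAt.compContinuousLinearMap ?_
    rw [hu0]
    exact ⟨r, hr.fderiv⟩
  obtain ⟨r', hr'⟩ := h1
  have h2 : HasFPowerSeriesAt (fun t => fderiv ℝ f (u t) (field T k x))
      ((ContinuousLinearMap.apply ℝ ℝ (field T k x)).compFormalMultilinearSeries
        (p.derivSeries.compContinuousLinearMap u)) 0 :=
    ⟨r', (ContinuousLinearMap.apply ℝ ℝ (field T k x)).comp_hasFPowerSeriesOnBall hr'⟩
  have htend : Tendsto u (𝓝[≠] 0) (𝓝 0) := by
    have := u.continuous.tendsto 0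
    rw [hu0] at this
    exact this.mono_left nhdsWithin_le_nhds
  have hev : ∀ᶠ t in 𝓝[≠] (0 : ℝ), fderiv ℝ f (u t) (field T k x) = 0 := by
    filter_upwards [htend.eventually hf, self_mem_nhdsWithin] with t ht ht0
    have hut : u t = t • x := ContinuousLinearMap.toSpanSingleton_apply _ _ _
    rw [hut, field_smul, map_smul, smul_eq_mul] at ht
    rw [hut]
    exact (mul_eq_zero.1 ht).resolve_left (pow_ne_zero 2 ht0)
  have hzero := h2.analyticAt.frequently_zero_iff_eventually_zero.1 hev.frequently
  have h1 : p.derivSeries n (fun _ => u 1) (field T k x) = 0 :=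
    congrArg (fun q => q n fun _ => 1) (h2.eq_zero_of_eventually hzero)
  rwa [show u 1 = x by simp [u]] at h1

/-- A constant direction which annihilates all polynomials constant along the vector field also
annihilates the analytic functions constant along the vector field. -/
lemma fderiv_apply_eq_zero_of_polynomial {T : ClassA} {k : ℝ} {v : Fin 6 → ℝ}
    (hv : ∀ P, fieldDer T k P = 0 → ∑ i, C (v i) * pderiv i P = 0)
    {W : Set (Fin 6 → ℝ)} {f : (Fin 6 → ℝ) → ℝ}
    (hf : IsAnalyticFirstIntegral (field T k) W f) {y : Fin 6 → ℝ} (hy : y ∈ W) :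
    fderiv ℝ f y v = 0 := by
  obtain ⟨p, r, hr⟩ := hf.analytic 0 hf.zero_mem
  have hX : ∀ᶠ x in 𝓝 0, fderiv ℝ f x (field T k x) = 0 := by
    filter_upwards [hf.isOpen.mem_nhds hf.zero_mem] with x hx using hf.derivative_eq_zero x hx
  have hterm : ∀ n x, p.derivSeries n (fun _ => x) v = 0 := by
    intro n x
    obtain ⟨P, hP⟩ := exists_mvPolynomial_eval_eq (p (n + 1))
    have hfd : ∀ x, fderiv ℝ (fun y => eval y P) x = p.derivSeries n fun _ => x := by
      intro x
      rw [funext hP]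
      exact fderiv_diag_eq_derivSeries p n x
    have hPX : fieldDer T k P = 0 := by
      refine MvPolynomial.funext fun x => ?_
      rw [← fderiv_eval_field, hfd, map_zero]
      exact derivSeries_field_eq_zero ⟨r, hr⟩ hX n x
    rw [← hfd, fderiv_eval_apply]
    simpa using congrArg (eval x) (hv P hPX)
  have han : AnalyticOnNhd ℝ (fun x => fderiv ℝ f x v) W := fun x hx =>
    ((ContinuousLinearMap.apply ℝ ℝ v).analyticAt _).comp (hf.analytic.fderiv x hx)
  refine han.eqOn_zero_of_preconnected_of_eventuallyEq_zero hf.isConnected.isPreconnected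
    hf.zero_mem ?_ hy
  filter_upwards [Metric.eball_mem_nhds (0 : Fin 6 → ℝ) hr.r_pos] with x hx
  have hs := (hr.fderiv.hasSum hx).mapL (ContinuousLinearMap.apply ℝ ℝ v)
  rw [zero_add] at hs
  refine hs.unique ?_
  simp only [ContinuousLinearMap.apply_apply, hterm]
  exact hasSum_zero

/-- The derivatives of an analytic first integral. -/
lemma fderiv_single_eq_zero {T : ClassA} {k : ℝ} (hk : k < 1)
    {W : Set (Fin 6 → ℝ)} {f : (Fin 6 → ℝ) → ℝ}
    (hf : IsAnalyticFirstIntegral (field T k) W f) {y : Fin 6 → ℝ} (hy : y ∈ W) :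
    fderiv ℝ f y (Pi.single 0 1) = 0 ∧ fderiv ℝ f y (Pi.single 1 1) = 0 ∧
      fderiv ℝ f y (Pi.single 2 1) = 0 ∧
      fderiv ℝ f y (Pi.single 3 1) + fderiv ℝ f y (Pi.single 4 1)
        + fderiv ℝ f y (Pi.single 5 1) = 0 ∧
      (T.n 0 ≠ 0 → fderiv ℝ f y (Pi.single 3 1) = 0) ∧
      (T.n 1 ≠ 0 → fderiv ℝ f y (Pi.single 4 1) = 0) ∧
      (T.n 2 ≠ 0 → fderiv ℝ f y (Pi.single 5 1) = 0) := by
  have hC : ∀ (a b : Fin 6), (C ((Pi.single a 1 : Fin 6 → ℝ) b) : MvPolynomial (Fin 6) ℝ)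
      = if b = a then 1 else 0 := by
    intro a b
    rw [Pi.single_apply]
    split_ifs <;> simp
  have key : ∀ a : Fin 6, (∀ P, fieldDer T k P = 0 → pderiv a P = 0) →
      fderiv ℝ f y (Pi.single a 1) = 0 := fun a ha =>
    fderiv_apply_eq_zero_of_polynomial (fun P hP => by simp [hC, ha P hP]) hf hy
  refine ⟨key 0 fun P hP => (pderiv_eq_zero_of_fieldDer_eq_zero hk hP).1,
    key 1 fun P hP => (pderiv_eq_zero_of_fieldDer_eq_zero hk hP).2.1,
    key 2 fun P hP => (pderiv_eq_zero_of_fieldDer_eq_zero hk hP).2.2.1, ?_,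
    fun hn => key 3 fun P hP => (pderiv_eq_zero_of_fieldDer_eq_zero hk hP).2.2.2.2.1 hn,
    fun hn => key 4 fun P hP => (pderiv_eq_zero_of_fieldDer_eq_zero hk hP).2.2.2.2.2.1 hn,
    fun hn => key 5 fun P hP => (pderiv_eq_zero_of_fieldDer_eq_zero hk hP).2.2.2.2.2.2 hn⟩
  rw [← map_add, ← map_add]
  refine fderiv_apply_eq_zero_of_polynomial (T := T) (k := k) (fun P hP => ?_) hf hy
  have := (pderiv_eq_zero_of_fieldDer_eq_zero hk hP).2.2.2.1
  simpa [Fin.sum_univ_six, hC] using this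

lemma fderiv_apply_eq_sum (f : (Fin 6 → ℝ) → ℝ) (y v : Fin 6 → ℝ) :
    fderiv ℝ f y v = ∑ i, v i * fderiv ℝ f y (Pi.single i 1) := by
  conv_lhs => rw [← Finset.univ_sum_single v, map_sum]
  refine Finset.sum_congr rfl fun i _ => ?_
  rw [← smul_eq_mul, ← map_smul, ← Pi.single_smul, smul_eq_mul, mul_one]

/-- A polynomial first integral is analytic on the whole space. -/
lemma IsPolynomialFirstIntegral.isAnalyticFirstIntegral {T : ClassA} {k : ℝ}
    {P : MvPolynomial (Fin 6) ℝ} (hP : IsPolynomialFirstIntegral (field T k) P) :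
    IsAnalyticFirstIntegral (field T k) Set.univ fun x => eval x P := by
  obtain ⟨U, hU⟩ := hP
  refine ⟨isOpen_univ, isConnected_univ, Set.mem_univ _, AnalyticOnNhd.eval_mvPolynomial P,
    fun ⟨c, hc⟩ => hU.nonconstant ⟨c, fun x _ => hc x (Set.mem_univ x)⟩, fun x _ => ?_⟩
  have hcont : Continuous fun x => eval x (fieldDer T k P) := MvPolynomial.continuous_eval _
  -- The derivative along the field is a polynomial, so its vanishing extends from the dense set `U`
  -- by continuity.
  have h0 : (fun x => eval x (fieldDer T k P)) = fun _ => 0 :=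
    Continuous.ext_on hU.dense hcont continuous_const fun x hx => by
      rw [← fderiv_eval_field]; exact hU.derivative_eq_zero x hx
  rw [fderiv_eval_field]
  exact congrFun h0 x

/-- There are no analytic first integrals if at least two structure constants do not vanish. -/
lemma not_isAnalyticFirstIntegral {T : ClassA} {k : ℝ} (hk : k < 1) (h0 : T.n 0 ≠ 0)
    (h1 : T.n 1 ≠ 0) {W : Set (Fin 6 → ℝ)} {f : (Fin 6 → ℝ) → ℝ} :
    ¬ IsAnalyticFirstIntegral (field T k) W f := by
  intro hf
  have hfd : Set.EqOn (fderiv ℝ f) 0 W := by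
    intro y hy
    obtain ⟨e0, e1, e2, e, e3, e4, -⟩ := fderiv_single_eq_zero hk hf hy
    rw [e3 h0, e4 h1, zero_add, zero_add] at e
    ext1 v
    rw [fderiv_apply_eq_sum, Fin.sum_univ_six, e0, e1, e2, e3 h0, e4 h1, e]
    simp
  refine hf.nonconstant ⟨f 0, fun x hx => ?_⟩
  exact hf.isOpen.is_const_of_fderiv_eq_zero hf.isConnected.isPreconnected
    hf.analytic.differentiableOn hfd hx hf.zero_mem

lemma fderiv_eval_K_apply (x v : Fin 6 → ℝ) : fderiv ℝ (fun y => eval y K) x v = v 4 - v 5 := by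
  rw [fderiv_eval_apply, Fin.sum_univ_six]
  simp [K, pderiv_X]
  ring

/-- The differential of an analytic first integral of type II is proportional to that of `K`. -/
lemma not_independentAt_of_typeII {k : ℝ} (hk : k < 1) {W : Set (Fin 6 → ℝ)}
    {f g : (Fin 6 → ℝ) → ℝ} (hf : IsAnalyticFirstIntegral (field .II k) W f) {y : Fin 6 → ℝ}
    (hy : y ∈ W) : ¬ IndependentAt ![g, fun x => eval x K, f] y := by
  intro hind
  obtain ⟨e0, e1, e2, e, e3, -, -⟩ := fderiv_single_eq_zero hk hf hy
  have e3 := e3 (by simp [ClassA.n])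
  have hfK : fderiv ℝ f y = fderiv ℝ f y (Pi.single 4 1) • fderiv ℝ (fun x => eval x K) y := by
    ext1 v
    rw [_root_.smul_apply, fderiv_eval_K_apply, fderiv_apply_eq_sum, Fin.sum_univ_six, e0, e1, e2, e3,
      smul_eq_mul]
    linear_combination v 5 * e - v 5 * e3
  -- The relation gives `g` coefficient 0, so `g` is arbitrary.
  have := Fintype.linearIndependent_iff.1 hind
    ![0, fderiv ℝ f y (Pi.single 4 1), -1] (by
      simp only [Fin.sum_univ_three]
      simp
      rw [← hfK, add_neg_cancel]) 2
  simp at this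

/-! ### Calculus of real powers of absolute values -/

section Calculus

variable {E : Type*} [NormedAddCommGroup E] [NormedSpace ℝ E]

lemma analyticAt_log_of_ne_zero {a : ℝ} (ha : a ≠ 0) : AnalyticAt ℝ Real.log a := by
  -- `Real.log` is log |y|, so squaring reduces negative arguments to positive ones.
  have h : AnalyticAt ℝ (fun y : ℝ => Real.log (y ^ 2) / 2) a :=
    ((analyticAt_id.pow 2).log (sq_pos_iff.2 ha)).div_const
  refine h.congr (Eventually.of_forall fun y => ?_)
  simp

lemma eventually_abs_rpow_eq {α : Type*} [TopologicalSpace α] {f g : α → ℝ} {x : α}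
    (hf : ContinuousAt f x) (h0 : f x ≠ 0) :
    (fun y => |f y| ^ g y) =ᶠ[𝓝 x] fun y => Real.exp (Real.log (f y) * g y) := by
  filter_upwards [hf.eventually_ne h0] with y hy
  rw [Real.rpow_def_of_pos (abs_pos.2 hy), Real.log_abs]

lemma analyticAt_abs_rpow {f g : E → ℝ} {x : E} (hf : AnalyticAt ℝ f x) (hg : AnalyticAt ℝ g x)
    (h0 : f x ≠ 0) : AnalyticAt ℝ (fun y => |f y| ^ g y) x := by
  have hlog : AnalyticAt ℝ (fun y => Real.log (f y)) x :=
    (analyticAt_log_of_ne_zero h0).comp hf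
  exact (hlog.mul hg).rexp'.congr (eventually_abs_rpow_eq hf.continuousAt h0).symm

lemma analyticAt_sqrt_of_pos {f : E → ℝ} {x : E} (hf : AnalyticAt ℝ f x) (h0 : 0 < f x) :
    AnalyticAt ℝ (fun y => √(f y)) x := by
  refine (analyticAt_abs_rpow hf (analyticAt_const (v := (1 / 2 : ℝ))) h0.ne').congr ?_
  filter_upwards [hf.continuousAt.eventually (lt_mem_nhds h0)] with y hy
  rw [Real.sqrt_eq_rpow, abs_of_pos hy]

lemma hasDerivAt_abs_rpow {f : ℝ → ℝ} {f' c t : ℝ} (hf : HasDerivAt f f' t) (h0 : f t ≠ 0) :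
    HasDerivAt (fun s => |f s| ^ c) (|f t| ^ c * (c * (f' / f t))) t := by
  have h := ((hf.log h0).mul_const c).exp
  have heq := eventually_abs_rpow_eq (g := fun _ => c) hf.continuousAt h0
  refine (h.congr_of_eventuallyEq heq).congr_deriv ?_
  rw [heq.eq_of_nhds]
  ring

/-- Serves for directional derivatives: on a line, x₁x₂x₃ is a cubic in t and F a quadratic, so the
linear coefficient can be read off. -/
lemma hasDerivAt_cubic (a b c d : ℝ) :
    HasDerivAt (fun t => a + t * b + t ^ 2 * c + t ^ 3 * d) b 0 := by
  have h := ((((hasDerivAt_id (0 : ℝ)).mul_const b).const_add a).add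
    ((hasDerivAt_pow 2 (0 : ℝ)).mul_const c)).add ((hasDerivAt_pow 3 (0 : ℝ)).mul_const d)
  exact h.congr_deriv (by simp)

lemma hasDerivAt_affine (a b : ℝ) : HasDerivAt (fun t => a + t * b) b 0 := by
  simpa using! ((hasDerivAt_id (0 : ℝ)).mul_const b).const_add a

lemma not_const_of_fderiv_ne_zero {f : E → ℝ} {U : Set E} (hU : IsOpen U) {x : E} (hx : x ∈ U)
    (h : fderiv ℝ f x ≠ 0) : ¬ ∃ c : ℝ, ∀ y ∈ U, f y = c := by
  rintro ⟨c, hc⟩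
  refine h ?_
  have : f =ᶠ[𝓝 x] fun _ => c := by
    filter_upwards [hU.mem_nhds hx] with y hy using hc y hy
  rw [this.fderiv_eq, fderiv_const_apply]

end Calculus

/-! ### Open dense domains -/

/-- A zero set with interior would make the polynomial vanish everywhere by the identity theorem,
including at `x`. -/
lemma dense_setOf_eval_ne_zero {σ : Type*} [Fintype σ] {P : MvPolynomial σ ℝ} {x : σ → ℝ}
    (hx : eval x P ≠ 0) : Dense {y | eval y P ≠ 0} := by
  have : {y | eval y P ≠ 0} = {y | eval y P = 0}ᶜ := rfl
  rw [this, ← interior_eq_empty_iff_dense_compl]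
  by_contra hne
  obtain ⟨z, hz⟩ := Set.nonempty_iff_ne_empty.2 hne
  refine hx ?_
  have := (AnalyticOnNhd.eval_mvPolynomial (𝕜 := ℝ) P)
    |>.eqOn_zero_of_preconnected_of_eventuallyEq_zero isPreconnected_univ (Set.mem_univ z)
      (by filter_upwards [mem_interior_iff_mem_nhds.1 hz] with y hy using hy)
  exact this (Set.mem_univ x)

lemma isOpen_setOf_eval_ne_zero {σ : Type*} [Fintype σ] (P : MvPolynomial σ ℝ) :
    IsOpen {y | eval y P ≠ 0} :=
  isOpen_ne_fun (MvPolynomial.continuous_eval P) continuous_const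

lemma regular_eq : regular = {x | eval x (X 0 * X 1 * X 2 : MvPolynomial (Fin 6) ℝ) ≠ 0} := by
  ext x; simp [regular]

lemma typeIDomain_eq : typeIDomain = {x | eval x (X 0 * X 1 * X 2 *
    (X 3 ^ 2 + X 4 ^ 2 + X 5 ^ 2 - X 3 * X 4 - X 4 * X 5 - X 3 * X 5) *
    ((X 3 + X 4 + X 5) ^ 2 -
      C 4 * (X 3 ^ 2 + X 4 ^ 2 + X 5 ^ 2 - X 3 * X 4 - X 4 * X 5 - X 3 * X 5)) :
      MvPolynomial (Fin 6) ℝ) ≠ 0} := by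
  ext x
  simp only [typeIDomain, Δ, Set.mem_ofPred_eq, map_mul, map_add, map_sub, map_pow, eval_X, eval_C,
    mul_ne_zero_iff, ne_eq, sub_eq_zero, and_assoc]

lemma isOpen_regular : IsOpen regular := regular_eq ▸ isOpen_setOf_eval_ne_zero _

lemma dense_regular : Dense regular :=
  regular_eq ▸ dense_setOf_eval_ne_zero (x := fun _ => 1) (by simp)

lemma isOpen_typeIDomain : IsOpen typeIDomain := typeIDomain_eq ▸ isOpen_setOf_eval_ne_zero _

lemma one_mem_typeIDomain : (![1, 1, 1, 1, 0, 0] : Fin 6 → ℝ) ∈ typeIDomain := by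
  simp [typeIDomain, Δ]

lemma dense_typeIDomain : Dense typeIDomain := by
  have h := one_mem_typeIDomain
  rw [typeIDomain_eq] at h ⊢
  exact dense_setOf_eval_ne_zero h

/-! ### The integrals `H` and `K` -/

lemma analyticAt_coord (i : Fin 6) (x : Fin 6 → ℝ) : AnalyticAt ℝ (fun y : Fin 6 → ℝ => y i) x :=
  (ContinuousLinearMap.proj (R := ℝ) (φ := fun _ : Fin 6 => ℝ) i).analyticAt x

lemma eval_FPoly (T : ClassA) (x : Fin 6 → ℝ) : eval x (FPoly T) = F T x := by
  simp [FPoly, F]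

lemma analyticAt_F (T : ClassA) (x : Fin 6 → ℝ) : AnalyticAt ℝ (F T) x := by
  rw [← funext (eval_FPoly T)]
  exact AnalyticOnNhd.eval_mvPolynomial (FPoly T) x (Set.mem_univ x)

lemma analyticAt_H (T : ClassA) (k : ℝ) {x : Fin 6 → ℝ} (hx : x ∈ regular) :
    AnalyticAt ℝ (H T k) x :=
  (analyticAt_abs_rpow (((analyticAt_coord 0 x).mul (analyticAt_coord 1 x)).mul
    (analyticAt_coord 2 x)) analyticAt_const hx).mul (analyticAt_F T x)

/-- The polar form of `F`. -/
def polarF (T : ClassA) (x v : Fin 6 → ℝ) : ℝ := F T (x + v) - F T x - F T v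

lemma fderiv_H_apply (T : ClassA) (k : ℝ) {x : Fin 6 → ℝ} (hx : x ∈ regular) (v : Fin 6 → ℝ) :
    fderiv ℝ (H T k) x v = |x 0 * x 1 * x 2| ^ ((k - 1) / 2) *
      ((k - 1) / 2 * (v 0 / x 0 + v 1 / x 1 + v 2 / x 2) * F T x + polarF T x v) := by
  rw [← (analyticAt_H T k hx).differentiableAt.lineDeriv_eq_fderiv]
  refine HasLineDerivAt.lineDeriv ?_
  have hne : x 0 * x 1 * x 2 ≠ 0 := hx
  obtain ⟨⟨h0, h1⟩, h2⟩ : (x 0 ≠ 0 ∧ x 1 ≠ 0) ∧ x 2 ≠ 0 := by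
    simpa [regular, mul_ne_zero_iff] using hx
  have hp : HasDerivAt (fun t : ℝ => (x + t • v) 0 * (x + t • v) 1 * (x + t • v) 2)
      (v 0 * x 1 * x 2 + x 0 * v 1 * x 2 + x 0 * x 1 * v 2) 0 :=
    (hasDerivAt_cubic (x 0 * x 1 * x 2) _
      (v 0 * v 1 * x 2 + v 0 * x 1 * v 2 + x 0 * v 1 * v 2) (v 0 * v 1 * v 2)).congr_of_eventuallyEq
      (Eventually.of_forall fun t => by simp; ring)
  have hF : HasDerivAt (fun t : ℝ => F T (x + t • v)) (polarF T x v) 0 :=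
    (hasDerivAt_cubic (F T x) _ (F T v) 0).congr_of_eventuallyEq
      (Eventually.of_forall fun t => by simp [polarF, F]; ring)
  have h := (hasDerivAt_abs_rpow (c := (k - 1) / 2) hp (by simpa using hne)).mul hF
  refine h.congr_deriv ?_
  simp only [zero_smul, add_zero]
  field_simp

/-- The logarithmic derivative of x₁x₂x₃ along the field is τ and that of F is ((1-k)/2) τ, so the
exponent (k-1)/2 balances them. -/
lemma fderiv_H_field (T : ClassA) (k : ℝ) {x : Fin 6 → ℝ} (hx : x ∈ regular) :
    fderiv ℝ (H T k) x (field T k x) = 0 := by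
  obtain ⟨⟨h0, h1⟩, h2⟩ : (x 0 ≠ 0 ∧ x 1 ≠ 0) ∧ x 2 ≠ 0 := by
    simpa [regular, mul_ne_zero_iff] using hx
  rw [fderiv_H_apply T k hx]
  have e0 : field T k x 0 / x 0 = -x 3 + x 4 + x 5 := mul_div_cancel_left₀ _ h0
  have e1 : field T k x 1 / x 1 = x 3 - x 4 + x 5 := mul_div_cancel_left₀ _ h1
  have e2 : field T k x 2 / x 2 = x 3 + x 4 - x 5 := mul_div_cancel_left₀ _ h2
  rw [e0, e1, e2]
  refine mul_eq_zero_of_right _ ?_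
  simp [polarF, F, field]
  ring

/-- The differential of `K` ignores x₁ and x₂. If that of `H` also vanished in both directions, the
x₂-direction would give F = 0, and then the x₁-direction would give x₁ = 0. -/
lemma independentAt_H_K {k : ℝ} (hk : k < 1) {x : Fin 6 → ℝ} (hx : x ∈ regular) :
    IndependentAt ![H .II k, fun y => eval y K] x := by
  obtain ⟨⟨h0, h1⟩, h2⟩ : (x 0 ≠ 0 ∧ x 1 ≠ 0) ∧ x 2 ≠ 0 := by
    simpa [regular, mul_ne_zero_iff] using hx
  have hp : |x 0 * x 1 * x 2| ^ ((k - 1) / 2) ≠ 0 :=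
    (Real.rpow_pos_of_pos (abs_pos.2 hx) _).ne'
  have hk' : (k - 1) / 2 ≠ 0 := by linarith
  refine Fintype.linearIndependent_iff.2 fun g hg => ?_
  have hv : ∀ v, g 0 * fderiv ℝ (H .II k) x v + g 1 * (v 4 - v 5) = 0 := fun v => by
    have := congrArg (fun L => L v) hg
    simpa [Fin.sum_univ_two, fderiv_eval_K_apply] using this
  have hg0 : g 0 = 0 := by
    have a0 := hv (Pi.single 0 1)
    have a1 := hv (Pi.single 1 1)
    rw [fderiv_H_apply .II k hx] at a0 a1
    generalize |x 0 * x 1 * x 2| ^ ((k - 1) / 2) = p at hp a0 a1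
    simp [hp, polarF, F, ClassA.n] at a0 a1
    rcases a0 with h | h
    · exact h
    rcases a1 with h' | h'
    · exact h'
    exfalso
    rcases h' with (h' | h') | h'
    · exact hk' (by linarith)
    · exact h1 h'
    · rw [h'] at h
      apply h0
      linear_combination h / 2
  have a4 := hv (Pi.single 4 1)
  rw [hg0] at a4
  intro i
  fin_cases i
  · exact hg0
  · simpa using a4

lemma isFirstIntegral_H_typeII {k : ℝ} (hk : k < 1) :
    IsFirstIntegral (field .II k) regular (H .II k) where
  isOpen := isOpen_regular
  dense := dense_regular
  contDiffOn := fun _ hx => (analyticAt_H .II k hx).contDiffAt.contDiffWithinAt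
  nonconstant := by
    have h1 : (fun _ => 1 : Fin 6 → ℝ) ∈ regular := by simp [regular]
    exact not_const_of_fderiv_ne_zero isOpen_regular h1 ((independentAt_H_K hk h1).ne_zero 0)
  derivative_eq_zero := fun _ hx => fderiv_H_field .II k hx

lemma isFirstIntegral_K_typeII (k : ℝ) :
    IsFirstIntegral (field .II k) Set.univ fun x => eval x K where
  isOpen := isOpen_univ
  dense := dense_univ
  contDiffOn := fun x _ =>
    (AnalyticOnNhd.eval_mvPolynomial (𝕜 := ℝ) K x (Set.mem_univ x)).contDiffAt.contDiffWithinAt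
  nonconstant := by
    refine not_const_of_fderiv_ne_zero isOpen_univ (Set.mem_univ 0) fun h => ?_
    have := fderiv_eval_K_apply 0 (Pi.single 4 1)
    rw [h] at this
    simp at this
  derivative_eq_zero := fun x _ => by
    rw [fderiv_eval_K_apply]
    simp [field, ClassA.n]

/-! ### Type I -/

/-- The first integrals of type I built from the ratio of two of the coordinates `x₁, x₂, x₃`. -/
def ratioIntegral (k : ℝ) (i j a b : Fin 6) (x : Fin 6 → ℝ) : ℝ :=
  |x i / x j| ^ ((1 - k) / 2) * quotient x ^ ((x a - x b) / √(Δ x))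

lemma Δ_pos {x : Fin 6 → ℝ} (hx : x ∈ typeIDomain) : 0 < Δ x := by
  refine lt_of_le_of_ne ?_ (Ne.symm hx.2.1)
  rw [Δ]
  nlinarith [sq_nonneg (x 3 - x 4), sq_nonneg (x 4 - x 5), sq_nonneg (x 3 - x 5)]

lemma analyticAt_Δ (x : Fin 6 → ℝ) : AnalyticAt ℝ Δ x := by
  have h := analyticAt_coord
  unfold Δ
  exact ((((((h 3 x).pow 2).add ((h 4 x).pow 2)).add ((h 5 x).pow 2)).sub
    ((h 3 x).mul (h 4 x))).sub ((h 4 x).mul (h 5 x))).sub ((h 3 x).mul (h 5 x))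

lemma trace_sub_mul_trace_add {x : Fin 6 → ℝ} (hx : x ∈ typeIDomain) :
    (x 3 + x 4 + x 5 - 2 * √(Δ x)) * (x 3 + x 4 + x 5 + 2 * √(Δ x))
      = (x 3 + x 4 + x 5) ^ 2 - 4 * Δ x := by
  linear_combination -4 * Real.sq_sqrt (Δ_pos hx).le

lemma trace_sub_ne_zero_and_trace_add_ne_zero {x : Fin 6 → ℝ} (hx : x ∈ typeIDomain) :
    x 3 + x 4 + x 5 - 2 * √(Δ x) ≠ 0 ∧ x 3 + x 4 + x 5 + 2 * √(Δ x) ≠ 0 := by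
  rw [← mul_ne_zero_iff, trace_sub_mul_trace_add hx]
  exact sub_ne_zero.2 hx.2.2

lemma analyticAt_ratioIntegral (k : ℝ) {i j : Fin 6} (a b : Fin 6) {x : Fin 6 → ℝ}
    (hx : x ∈ typeIDomain) (hi : x i ≠ 0) (hj : x j ≠ 0) :
    AnalyticAt ℝ (ratioIntegral k i j a b) x := by
  have h := analyticAt_coord
  obtain ⟨hs, hs'⟩ := trace_sub_ne_zero_and_trace_add_ne_zero hx
  have hsq := analyticAt_sqrt_of_pos (analyticAt_Δ x) (Δ_pos hx)
  have htr := ((h 3 x).add (h 4 x)).add (h 5 x)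
  have h2 := (analyticAt_const (𝕜 := ℝ) (v := (2 : ℝ)) (x := x)).mul hsq
  exact (analyticAt_abs_rpow ((h i x).div (h j x) hj) analyticAt_const (div_ne_zero hi hj)).mul
    (analyticAt_abs_rpow ((htr.sub h2).div (htr.add h2) hs')
      (((h a x).sub (h b x)).div hsq (Real.sqrt_pos.2 (Δ_pos hx)).ne') (div_ne_zero hs hs'))

/-- In a direction with equal last three entries, Δ and the exponents are constant; only the ratio
and the trace move. The factor √Δ from differentiating log Q cancels the one in the exponent. -/
lemma fderiv_ratioIntegral_apply (k : ℝ) {i j a b : Fin 6} {x : Fin 6 → ℝ}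
    (hx : x ∈ typeIDomain) (hi : x i ≠ 0) (hj : x j ≠ 0) {v : Fin 6 → ℝ} (h34 : v 3 = v 4)
    (h45 : v 4 = v 5) (hab : v a = v b) :
    fderiv ℝ (ratioIntegral k i j a b) x v = ratioIntegral k i j a b x *
      ((1 - k) / 2 * (v i / x i - v j / x j)
        + (x a - x b) * (12 * v 4 / ((x 3 + x 4 + x 5) ^ 2 - 4 * Δ x))) := by
  rw [← (analyticAt_ratioIntegral k a b hx hi hj).differentiableAt.lineDeriv_eq_fderiv]
  refine HasLineDerivAt.lineDeriv ?_
  obtain ⟨hs, hs'⟩ := trace_sub_ne_zero_and_trace_add_ne_zero hx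
  have hΔ : ∀ t : ℝ, Δ (x + t • v) = Δ x := fun t => by
    simp [Δ, h34, h45]; ring
  have h1 : HasDerivAt (fun t : ℝ => (x i + t * v i) / (x j + t * v j))
      ((v i * x j - x i * v j) / x j ^ 2) 0 := by
    refine ((hasDerivAt_affine (x i) (v i)).div (hasDerivAt_affine (x j) (v j))
      (by simpa using hj)).congr_deriv (by simp)
  have h2 : HasDerivAt (fun t : ℝ => (x 3 + x 4 + x 5 - 2 * √(Δ x) + t * (3 * v 4)) /
      (x 3 + x 4 + x 5 + 2 * √(Δ x) + t * (3 * v 4)))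
      ((3 * v 4 * (x 3 + x 4 + x 5 + 2 * √(Δ x)) - (x 3 + x 4 + x 5 - 2 * √(Δ x)) * (3 * v 4))
        / (x 3 + x 4 + x 5 + 2 * √(Δ x)) ^ 2) 0 := by
    refine ((hasDerivAt_affine _ (3 * v 4)).div (hasDerivAt_affine _ (3 * v 4))
      (by simpa using hs')).congr_deriv (by simp)
  have h := (hasDerivAt_abs_rpow (c := (1 - k) / 2) h1
    (by simpa using ⟨hi, hj⟩)).mul
      (hasDerivAt_abs_rpow (c := (x a - x b) / √(Δ x)) h2 (by simpa using ⟨hs, hs'⟩))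
  refine (h.congr_of_eventuallyEq (Eventually.of_forall fun t => ?_)).congr_deriv ?_
  · simp only [ratioIntegral, quotient, hΔ]
    simp only [Pi.mul_apply, Pi.add_apply, Pi.smul_apply, smul_eq_mul, hab, h34, ← h45]
    congr 2
    · congr 2 <;> ring
    · congr 1; ring
  · have hsq := (Real.sqrt_pos.2 (Δ_pos hx)).ne'
    rw [← trace_sub_mul_trace_add hx]
    simp only [zero_mul, add_zero, ratioIntegral, quotient]
    generalize |x i / x j| ^ ((1 - k) / 2) = A
    generalize |(x 3 + x 4 + x 5 - 2 * √(Δ x)) / (x 3 + x 4 + x 5 + 2 * √(Δ x))|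
      ^ ((x a - x b) / √(Δ x)) = B
    generalize √(Δ x) = q at *
    field_simp
    ring

/-- Turns the denominator in the derivative of log Q into a multiple of F, which cancels against the
F in the field. -/
lemma typeI_discriminant (x : Fin 6 → ℝ) : (x 3 + x 4 + x 5) ^ 2 - 4 * Δ x = -3 * F .I x := by
  simp [Δ, F, ClassA.n]; ring

lemma F_typeI_ne_zero {x : Fin 6 → ℝ} (hx : x ∈ typeIDomain) : F .I x ≠ 0 := by
  intro h
  have := typeI_discriminant x
  rw [h, mul_zero, sub_eq_zero] at this
  exact hx.2.2 this

lemma field_typeI_const (k : ℝ) (x : Fin 6 → ℝ) :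
    field .I k x 3 = (k - 1) / 4 * F .I x ∧ field .I k x 4 = (k - 1) / 4 * F .I x ∧
      field .I k x 5 = (k - 1) / 4 * F .I x := by
  refine ⟨?_, ?_, ?_⟩ <;> simp [field, ClassA.n]

lemma coord_ne_zero {x : Fin 6 → ℝ} (hx : x ∈ typeIDomain) : x 0 ≠ 0 ∧ x 1 ≠ 0 ∧ x 2 ≠ 0 := by
  have := hx.1
  simpa [mul_ne_zero_iff, and_assoc] using this

lemma fderiv_coord_sub_apply (i j : Fin 6) (x v : Fin 6 → ℝ) :
    fderiv ℝ (fun y : Fin 6 → ℝ => y i - y j) x v = v i - v j := by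
  have h := ((ContinuousLinearMap.proj (R := ℝ) (φ := fun _ : Fin 6 => ℝ) i).hasFDerivAt
    (x := x)).sub ((ContinuousLinearMap.proj (R := ℝ) (φ := fun _ : Fin 6 => ℝ) j).hasFDerivAt
    (x := x))
  rw [HasFDerivAt.fderiv (f := fun y : Fin 6 → ℝ => y i - y j) h]
  rfl

lemma analyticOnNhd_typeIIntegrals (k : ℝ) (i : Fin 5) :
    AnalyticOnNhd ℝ (typeIIntegrals k i) typeIDomain := by
  intro x hx
  obtain ⟨h0, h1, h2⟩ := coord_ne_zero hx
  fin_cases i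
  · exact (analyticAt_coord 3 x).sub (analyticAt_coord 4 x)
  · exact (analyticAt_coord 3 x).sub (analyticAt_coord 5 x)
  · exact analyticAt_H .I k hx.1
  · exact analyticAt_ratioIntegral k 3 4 hx h0 h1
  · exact analyticAt_ratioIntegral k 4 5 hx h1 h2

lemma fderiv_typeIIntegrals_field (k : ℝ) (i : Fin 5) {x : Fin 6 → ℝ} (hx : x ∈ typeIDomain) :
    fderiv ℝ (typeIIntegrals k i) x (field .I k x) = 0 := by
  obtain ⟨h0, h1, h2⟩ := coord_ne_zero hx
  obtain ⟨v3, v4, v5⟩ := field_typeI_const k x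
  have hF := F_typeI_ne_zero hx
  have e0 : field .I k x 0 / x 0 = -x 3 + x 4 + x 5 := mul_div_cancel_left₀ _ h0
  have e1 : field .I k x 1 / x 1 = x 3 - x 4 + x 5 := mul_div_cancel_left₀ _ h1
  have e2 : field .I k x 2 / x 2 = x 3 + x 4 - x 5 := mul_div_cancel_left₀ _ h2
  fin_cases i
  · exact (fderiv_coord_sub_apply 3 4 x _).trans (by rw [v3, v4, sub_self])
  · exact (fderiv_coord_sub_apply 3 5 x _).trans (by rw [v3, v5, sub_self])
  · exact fderiv_H_field .I k hx.1
  · refine (fderiv_ratioIntegral_apply k hx h0 h1 (v3.trans v4.symm) (v4.trans v5.symm)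
      (v3.trans v4.symm)).trans (mul_eq_zero_of_right _ ?_)
    rw [typeI_discriminant, v4, e0, e1]
    field_simp
    ring
  · refine (fderiv_ratioIntegral_apply k hx h1 h2 (v3.trans v4.symm) (v4.trans v5.symm)
      (v4.trans v5.symm)).trans (mul_eq_zero_of_right _ ?_)
    rw [typeI_discriminant, v4, e1, e2]
    field_simp
    ring

lemma ratioIntegral_ne_zero (k : ℝ) {i j : Fin 6} (a b : Fin 6) {x : Fin 6 → ℝ}
    (hx : x ∈ typeIDomain) (hi : x i ≠ 0) (hj : x j ≠ 0) : ratioIntegral k i j a b x ≠ 0 := by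
  obtain ⟨hs, hs'⟩ := trace_sub_ne_zero_and_trace_add_ne_zero hx
  exact (mul_pos (Real.rpow_pos_of_pos (abs_pos.2 (div_ne_zero hi hj)) _)
    (Real.rpow_pos_of_pos (abs_pos.2 (div_ne_zero hs hs')) _)).ne'

lemma independentAt_typeIIntegrals {k : ℝ} (hk : k < 1) {x : Fin 6 → ℝ} (hx : x ∈ typeIDomain) :
    IndependentAt (typeIIntegrals k) x := by
  obtain ⟨h0, h1, h2⟩ := coord_ne_zero hx
  have hk' : 1 - k ≠ 0 := by linarith
  have hk2 : k - 1 ≠ 0 := by linarith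
  have hF := F_typeI_ne_zero hx
  have hp : |x 0 * x 1 * x 2| ^ ((k - 1) / 2) ≠ 0 :=
    (Real.rpow_pos_of_pos (abs_pos.2 hx.1) _).ne'
  have hA := ratioIntegral_ne_zero k 3 4 hx h0 h1
  have hB := ratioIntegral_ne_zero k 4 5 hx h1 h2
  refine Fintype.linearIndependent_iff.2 fun g hg => ?_
  have hv : ∀ v, g 0 * (v 3 - v 4) + g 1 * (v 3 - v 5) + g 2 * fderiv ℝ (H .I k) x v
      + g 3 * fderiv ℝ (ratioIntegral k 0 1 3 4) x v
      + g 4 * fderiv ℝ (ratioIntegral k 1 2 4 5) x v = 0 := fun v => by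
    have := congrArg (fun L => L v) hg
    rw [← fderiv_coord_sub_apply 3 4 x v, ← fderiv_coord_sub_apply 3 5 x v]
    simp only [Fin.sum_univ_five, _root_.add_apply, _root_.smul_apply, smul_eq_mul,
      _root_.zero_apply] at this
    exact this
  have hx' : x ∈ regular := hx.1
  have hw : ∀ v : Fin 6 → ℝ, v 3 = 0 → v 4 = 0 → v 5 = 0 →
      g 2 * (|x 0 * x 1 * x 2| ^ ((k - 1) / 2) *
        ((k - 1) / 2 * (v 0 / x 0 + v 1 / x 1 + v 2 / x 2) * F .I x))
      + g 3 * (ratioIntegral k 0 1 3 4 x * ((1 - k) / 2 * (v 0 / x 0 - v 1 / x 1)))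
      + g 4 * (ratioIntegral k 1 2 4 5 x * ((1 - k) / 2 * (v 1 / x 1 - v 2 / x 2))) = 0 := by
    intro v h3 h4 h5
    have := hv v
    rw [fderiv_H_apply .I k hx', fderiv_ratioIntegral_apply k hx h0 h1 (h3.trans h4.symm)
      (h4.trans h5.symm) (h3.trans h4.symm), fderiv_ratioIntegral_apply k hx h1 h2
      (h3.trans h4.symm) (h4.trans h5.symm) (h4.trans h5.symm)] at this
    have hpol : polarF .I x v = 0 := by simp [polarF, F, ClassA.n, h3, h4, h5]
    rw [h3, h4, h5, hpol] at this
    simpa using this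
  generalize |x 0 * x 1 * x 2| ^ ((k - 1) / 2) = p at hp hw
  -- Along xᵢ∂ᵢ, i = 1, 2, 3, the logarithmic differentials of the ratios have weights (1, -1, 0)
  -- and (0, 1, -1), while `H` contributes equally to all three. Summing isolates `g 2`; the first
  -- and third equations then give `g 3` and `g 4`.
  have w0 := hw (Pi.single 0 (x 0)) (by simp) (by simp) (by simp)
  have w1 := hw (Pi.single 1 (x 1)) (by simp) (by simp) (by simp)
  have w2 := hw (Pi.single 2 (x 2)) (by simp) (by simp) (by simp)
  simp [h0] at w0
  simp [h1] at w1
  simp [h2] at w2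
  have g2 : g 2 = 0 := by
    have : g 2 * (p * ((k - 1) * F .I x)) = 0 := by
      linear_combination (2 / 3) * (w0 + w1 + w2)
    exact (mul_eq_zero.1 this).resolve_right (mul_ne_zero hp (mul_ne_zero hk2 hF))
  rw [g2] at w0 w2
  have g3 : g 3 = 0 := by simpa [hA, hk'] using w0
  have g4 : g 4 = 0 := by simpa [hB, hk'] using w2
  have w4 := hv (Pi.single 4 1)
  have w5 := hv (Pi.single 5 1)
  rw [g2, g3, g4] at w4 w5
  intro i
  fin_cases i
  · simpa using w4
  · simpa using w5
  · exact g2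
  · exact g3
  · exact g4

lemma isFirstIntegral_typeIIntegrals {k : ℝ} (hk : k < 1) (i : Fin 5) :
    IsFirstIntegral (field .I k) typeIDomain (typeIIntegrals k i) where
  isOpen := isOpen_typeIDomain
  dense := dense_typeIDomain
  contDiffOn := fun x hx => (analyticOnNhd_typeIIntegrals k i x hx).contDiffAt.contDiffWithinAt
  nonconstant := not_const_of_fderiv_ne_zero isOpen_typeIDomain one_mem_typeIDomain
    ((independentAt_typeIIntegrals hk one_mem_typeIDomain).ne_zero i)
  derivative_eq_zero := fun _ hx => fderiv_typeIIntegrals_field k i hx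

end Bianchi

end

theorem theorem1 (k : ℝ) (hk0 : 0 ≤ k) (hk1 : k < 1) :
    -- (a) type I is completely integrable, by five explicit first integrals
    (Bianchi.CompletelyIntegrable (Bianchi.field .I k) ∧
      (∀ i, Bianchi.IsFirstIntegral (Bianchi.field .I k) Bianchi.typeIDomain
        (Bianchi.typeIIntegrals k i)) ∧
      (∀ i, AnalyticOnNhd ℝ (Bianchi.typeIIntegrals k i) Bianchi.typeIDomain) ∧
      (∀ x ∈ Bianchi.typeIDomain, Bianchi.IndependentAt (Bianchi.typeIIntegrals k) x)) ∧
    -- (b) type II has the independent first integrals `𝓗` and `K`, and no polynomial or analytic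
    -- first integral is independent of them at any point
    (Bianchi.IsFirstIntegral (Bianchi.field .II k) Bianchi.regular (Bianchi.H .II k) ∧
      Bianchi.IsFirstIntegral (Bianchi.field .II k) Set.univ
        (fun x => MvPolynomial.eval x Bianchi.K) ∧
      (∀ x ∈ Bianchi.regular, Bianchi.IndependentAt
        ![Bianchi.H .II k, fun y => MvPolynomial.eval y Bianchi.K] x) ∧
      (∀ P, Bianchi.IsPolynomialFirstIntegral (Bianchi.field .II k) P →
        ∀ x ∈ Bianchi.regular, ¬ Bianchi.IndependentAt
          ![Bianchi.H .II k, fun y => MvPolynomial.eval y Bianchi.K,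
            fun y => MvPolynomial.eval y P] x) ∧
      (∀ W f, Bianchi.IsAnalyticFirstIntegral (Bianchi.field .II k) W f →
        ∀ x ∈ W ∩ Bianchi.regular, ¬ Bianchi.IndependentAt
          ![Bianchi.H .II k, fun y => MvPolynomial.eval y Bianchi.K, f] x)) ∧
    -- (c) types VI₀ and VII₀
    (∀ T : Bianchi.ClassA, T = .VI0 ∨ T = .VII0 →
      (¬ ∃ P, Bianchi.IsPolynomialFirstIntegral (Bianchi.field T k) P) ∧
      (¬ ∃ W f, Bianchi.IsAnalyticFirstIntegral (Bianchi.field T k) W f)) ∧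
    -- (d) types VIII and IX
    (∀ T : Bianchi.ClassA, T = .VIII ∨ T = .IX →
      (¬ ∃ P, Bianchi.IsPolynomialFirstIntegral (Bianchi.field T k) P) ∧
      (¬ ∃ W f, Bianchi.IsAnalyticFirstIntegral (Bianchi.field T k) W f)) := by
  -- Types VI₀, VII₀, VIII and IX are treated alike: n₁ and n₂ are nonzero in all four, and n₃ plays
  -- no role.
  have hcd : ∀ T : Bianchi.ClassA, T.n 0 ≠ 0 → T.n 1 ≠ 0 →
      (¬ ∃ P, Bianchi.IsPolynomialFirstIntegral (Bianchi.field T k) P) ∧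
      (¬ ∃ W f, Bianchi.IsAnalyticFirstIntegral (Bianchi.field T k) W f) := fun T h0 h1 =>
    ⟨fun ⟨_, hP⟩ => Bianchi.not_isAnalyticFirstIntegral hk1 h0 h1 hP.isAnalyticFirstIntegral,
      fun ⟨_, _, hf⟩ => Bianchi.not_isAnalyticFirstIntegral hk1 h0 h1 hf⟩
  refine ⟨⟨⟨Bianchi.typeIDomain, Bianchi.typeIIntegrals k,
      Bianchi.isFirstIntegral_typeIIntegrals hk1,
      fun _ hx => Bianchi.independentAt_typeIIntegrals hk1 hx⟩,
      Bianchi.isFirstIntegral_typeIIntegrals hk1, Bianchi.analyticOnNhd_typeIIntegrals k,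
      fun _ hx => Bianchi.independentAt_typeIIntegrals hk1 hx⟩,
    ⟨Bianchi.isFirstIntegral_H_typeII hk1, Bianchi.isFirstIntegral_K_typeII k,
      fun _ hx => Bianchi.independentAt_H_K hk1 hx,
      fun _ hP x _ => Bianchi.not_independentAt_of_typeII hk1 hP.isAnalyticFirstIntegral
        (Set.mem_univ x),
      fun _ _ hf _ hx => Bianchi.not_independentAt_of_typeII hk1 hf hx.1⟩, ?_, ?_⟩
  · rintro T (rfl | rfl) <;> exact hcd _ (by simp [Bianchi.ClassA.n]) (by simp [Bianchi.ClassA.n])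
  · rintro T (rfl | rfl) <;> exact hcd _ (by simp [Bianchi.ClassA.n]) (by simp [Bianchi.ClassA.n])
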